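/- **Problem.** Consider convex piecewise-linear total variation problems on a chain with nodes $1,\dots,n$, edges $(i,i+1)$ for $1\le i\le n-1$, and root $n$: minimize $$f(x)=\sum_{i=1}^n f_i(x_i)+\sum_{i=1}^{n-1} f_{i,i+1}(x_{i+1}-x_i),\qquad x\in\mathbb R^n .$$ Each $f_i$ is a convex continuous piecewise-linear function given by a sequence $(s_{i,0},b_{i,1},s_{i,1},\dots,b_{i,K},s_{i,K})$ of breakpoints $b_{i,1}\le\dots\le b_{i,K}$ and slopes $s_{i,0}\le\dots\le s_{i,K}$. Each pairwise term is $f_{i,i+1}(z)=w^-_{i}z$ for $z<0$ and $f_{i,i+1}(z)=w^+_{i}z$ for $z\ge 0$, with $w^-_{i}\le w^+_{i}$. It is assumed that $f$ attains its minimum. **The values $\lambda^+$.** Let $g_i$ be the left-continuous derivative of $f_i$, put $\widehat m_1=g_1$, and $$\widehat m_{i+1}(z)=g_{i+1}(z)+\min\{\max\{\widehat m_i(z),w^-_{i}\},w^+_{i}\}.$$ A value $\lambda^+_{i,i+1}$ of the edge $(i,i+1)$ is any element of the interval $$\bigl[\sup\{z\in\mathbb R:\widehat m_i(z)<w^+_{i}\},\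 \inf\{z\in\mathbb R:\widehat m_i(z)>w^+_{i}\}\bigr]\subseteq[-\infty,+\infty],$$ with $\sup\varnothing=-\infty$ and $\inf\varnothing=+\infty$. **Comparison-based algorithms.** A comparison-based algorithm for given $n$ and $K$ assigns to each choice of slopes and weights (in an arbitrary way) a finite decision tree. At every inner node two arithmetic expressions (built with $+,-,\times,\div$ from the breakpoints $b_{i,p}$ and real constants, with division by zero giving zero) are compared, and the computation branches on the outcome $<$, $=$ or $>$. Every leaf specifies for each edge an output, which is such an expression or $\pm\infty$. Only the comparisons made at inner nodes are counted. **Proposition.** Any comparison-based algorithm that computes values $\lambda^+_{i,i+1}$ for all edges requires $\Omega(n\log n)$ comparisons in the worst case. Precisely: there are constants $c>0$ and $n_0$ such that for all $n\ge n_0$, all $K\ge 1$, and every comparison-based algorithm for $n$ and $K$ that returns a value $\lambda^+_{i,i+1}$ for every edge on every instance as above, there is an instance with $n$ nodes and $K$ breakpoints per unary term on which the algorithm makes at least $c\,n\log n$ comparisons. -/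

import Mathlib

noncomputable section

namespace TVChain

/-! ### Convex piecewise-linear total variation problems on a chain

The chain has nodes `0, …, n - 1` (the last one is the root) and edges `e = (e, e + 1)` for
`e < n - 1`. -/

/-- The numerical data other than the breakpoints: the slopes `s₀ ≤ … ≤ s_K` of each unary term and
the two slopes of each pairwise term. -/
structure Coefficients (n K : ℕ) where
  slope : Fin n → Fin (K + 1) → ℝ
  wMinus : Fin (n - 1) → ℝ
  wPlus : Fin (n - 1) → ℝ

/-- An instance: the unary term of node `i` is given by the sequence
`(s₀, b₁, s₁, …, s_{K-1}, b_K, s_K)` of slopes and breakpoints. -/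
structure Instance (n K : ℕ) extends Coefficients n K where
  breakpoint : Fin n → Fin K → ℝ

/-- The initial node of an edge. -/
def tail {n : ℕ} (e : Fin (n - 1)) : Fin n := ⟨e, by omega⟩

/-- The final node of an edge. -/
def head {n : ℕ} (e : Fin (n - 1)) : Fin n := ⟨e + 1, by omega⟩

/-- Projection to the interval `[a, b]`. -/
def clip (a b z : ℝ) : ℝ := min (max z a) b

namespace Instance

variable {n K : ℕ} (P : Instance n K)

/-- The unary term `f_i` (normalized by an irrelevant additive constant): the continuous
piecewise-linear function with the given slopes and breakpoints. -/
def unary (i : Fin n) (z : ℝ) : ℝ :=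
  P.slope i 0 * z
    + ∑ p : Fin K, (P.slope i p.succ - P.slope i p.castSucc) * max (z - P.breakpoint i p) 0

/-- The left-continuous derivative `g_i` of `f_i`. -/
def unaryDeriv (i : Fin n) (z : ℝ) : ℝ :=
  P.slope i 0
    + ∑ p : Fin K, if P.breakpoint i p < z then P.slope i p.succ - P.slope i p.castSucc else 0

/-- The pairwise term `f_ij`. -/
def pairwise (e : Fin (n - 1)) (z : ℝ) : ℝ :=
  if z < 0 then P.wMinus e * z else P.wPlus e * z

/-- The objective `f(x) = ∑ f_i(x_i) + ∑ f_ij(x_j - x_i)`. -/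
def objective (x : Fin n → ℝ) : ℝ :=
  ∑ i, P.unary i (x i) + ∑ e, P.pairwise e (x (head e) - x (tail e))

/-- The standing assumptions: breakpoints are listed in non-decreasing order, all terms are convex,
and the objective attains its minimum. -/
structure Admissible : Prop where
  breakpoint_mono : ∀ i, Monotone (P.breakpoint i)
  slope_mono : ∀ i, Monotone (P.slope i)
  wMinus_le_wPlus : ∀ e, P.wMinus e ≤ P.wPlus e
  attains_min : ∃ x, ∀ y, P.objective x ≤ P.objective y

/-- The message derivatives of the forward pass: `messageDeriv i` is
`m̂_i = g_i + m_{i-1,i}`, where `m_{i-1,i} = clip_{[w⁻,w⁺]}(m̂_{i-1})` for the edge `(i - 1, i)`. -/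
def messageDeriv : (i : ℕ) → i < n → ℝ → ℝ
  | 0, h, z => P.unaryDeriv ⟨0, h⟩ z
  | i + 1, h, z =>
      P.unaryDeriv ⟨i + 1, h⟩ z
        + clip (P.wMinus ⟨i, by omega⟩) (P.wPlus ⟨i, by omega⟩) (messageDeriv i (by omega) z)

/-- `l` is a value `λ⁺` of the edge `e = (i, j)`: it is a (possibly infinite) point where the
non-decreasing function `m̂_i` crosses the level `w⁺_ij`. -/
def IsLambdaPlus (e : Fin (n - 1)) (l : EReal) : Prop :=
  sSup ((fun z : ℝ => (z : EReal)) '' {z | P.messageDeriv e (by omega) z < P.wPlus e}) ≤ l ∧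
  l ≤ sInf ((fun z : ℝ => (z : EReal)) '' {z | P.wPlus e < P.messageDeriv e (by omega) z})

end Instance

/-! ### Comparison-based algorithms -/

/-- Arithmetic expressions in real inputs indexed by `ι`, with real constants. -/
inductive Expr (ι : Type) : Type
  | input (i : ι)
  | const (c : ℝ)
  | add (s t : Expr ι)
  | sub (s t : Expr ι)
  | mul (s t : Expr ι)
  | div (s t : Expr ι)

/-- The value of an expression (division by zero gives zero). -/
def Expr.eval {ι : Type} (x : ι → ℝ) : Expr ι → ℝ
  | input i => x i
  | const c => c
  | add s t => s.eval x + t.eval x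
  | sub s t => s.eval x - t.eval x
  | mul s t => s.eval x * t.eval x
  | div s t => s.eval x / t.eval x

/-- An output value: an expression, or `-∞` or `+∞`. -/
inductive Output (ι : Type) : Type
  | negInf
  | posInf
  | real (s : Expr ι)

/-- The value of an output. -/
def Output.eval {ι : Type} (x : ι → ℝ) : Output ι → EReal
  | negInf => ⊥
  | posInf => ⊤
  | real s => (s.eval x : ℝ)

/-- Comparison trees over inputs indexed by `ι`. An inner node compares two expressions and branches
on the three possible results; a leaf gives one output for each element of `o`. -/
inductive CompTree (ι o : Type) : Type
  | leaf (out : o → Output ι)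
  | compare (s t : Expr ι) (ifLt ifEq ifGt : CompTree ι o)

namespace CompTree

variable {ι o : Type}

/-- The outputs on the input `x`. -/
def result (x : ι → ℝ) : CompTree ι o → o → EReal
  | leaf out => fun k => (out k).eval x
  | compare s t a b c =>
      match cmp (s.eval x) (t.eval x) with
      | .lt => a.result x
      | .eq => b.result x
      | .gt => c.result x

/-- The number of comparisons made on the input `x`. -/
def comparisons (x : ι → ℝ) : CompTree ι o → ℕ
  | leaf _ => 0
  | compare s t a b c =>
      1 + match cmp (s.eval x) (t.eval x) with
        | .lt => a.comparisons x
        | .eq => b.comparisons x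
        | .gt => c.comparisons x

end CompTree

/-- A comparison-based algorithm for chains with `n` nodes and unary terms with `K` breakpoints.
It knows the slopes and weights and may process them in any way free of charge; the breakpoints are
accessed only through (free) arithmetic and (counted) comparisons. -/
def Algorithm (n K : ℕ) : Type := Coefficients n K → CompTree (Fin n × Fin K) (Fin (n - 1))

namespace Algorithm

variable {n K : ℕ} (A : Algorithm n K)

/-- The value that the algorithm returns for the edge `e`. -/
def result (P : Instance n K) (e : Fin (n - 1)) : EReal :=
  (A P.toCoefficients).result (fun q => P.breakpoint q.1 q.2) e

/-- The number of comparisons made on the instance `P`. -/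
def comparisons (P : Instance n K) : ℕ :=
  (A P.toCoefficients).comparisons fun q => P.breakpoint q.1 q.2

/-- The algorithm computes the values `λ⁺` of all edges on every admissible instance. -/
def ComputesLambdaPlus : Prop :=
  ∀ P : Instance n K, P.Admissible → ∀ e, P.IsLambdaPlus e (A.result P e)

end Algorithm

end TVChain

end

namespace TVChain

/-! ### Expressions at algebraically independent inputs -/

/-! Computing the values `λ⁺` is at least as hard as sorting `n / 2` numbers. Each of the first `n /
2` nodes contributes a unit jump at its own value, so the message past them counts the values below
`z`. The remaining edges only cap this count, at half-integer levels that drop by one per edge, and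
the point where level `k + 1/2` is crossed is the value of rank `k`, counted from `0`
(`sortingInstance_lambdaPlus`).

Returning sorted numbers does not by itself force many leaves, because an output may be any
arithmetic expression and one expression might serve several input orders. This is excluded by
taking values algebraically independent over the field generated by the constants at the leaves: an
expression is then a rational function, and being equal to `a k` makes it a single variable
(`Expr.symm_apply_eq`). Distinct permutations thus reach distinct leaves, so `(n / 2)! ≤ 3 ^ d` by
`card_le_three_pow`, and taking logarithms gives the bound. -/

/-- The constants of an expression. -/
def Expr.constants {ι : Type} : Expr ι → Set ℝ
  | input _ => ∅
  | const c => {c}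
  | add s t => s.constants ∪ t.constants
  | sub s t => s.constants ∪ t.constants
  | mul s t => s.constants ∪ t.constants
  | div s t => s.constants ∪ t.constants

/-- The constants of an output. -/
def Output.constants {ι : Type} : Output ι → Set ℝ
  | negInf => ∅
  | posInf => ∅
  | real s => s.constants

/-- The constants of the outputs at the leaves of a tree. -/
def CompTree.constants {ι o : Type} : CompTree ι o → Set ℝ
  | leaf out => ⋃ k, (out k).constants
  | compare _ _ a b c => a.constants ∪ (b.constants ∪ c.constants)

theorem Expr.countable_constants {ι : Type} (s : Expr ι) : s.constants.Countable := by
  induction s <;> simp_all [Expr.constants]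

theorem Output.countable_constants {ι : Type} (s : Output ι) : s.constants.Countable := by
  cases s <;> simp [Output.constants, Expr.countable_constants]

theorem CompTree.countable_constants {ι o : Type} [Countable o] (T : CompTree ι o) :
    T.constants.Countable := by
  induction T with
  | leaf out => exact Set.countable_iUnion fun k => (out k).countable_constants
  | compare s t a b c ha hb hc => exact ha.union (hb.union hc)

/-- Expressions commute with homomorphisms of fields, also where a division by zero occurs. -/
theorem Expr.exists_lift_eval {ι F : Type} [Field F] (φ ψ : F →+* ℝ) {x y : ι → ℝ}
    (hxy : ∀ i, ∃ u, φ u = x i ∧ ψ u = y i) (s : Expr ι)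
    (hs : ∀ c ∈ s.constants, ∃ u, φ u = c ∧ ψ u = c) :
    ∃ u, φ u = s.eval x ∧ ψ u = s.eval y := by
  induction s with
  | input i => exact hxy i
  | const c => exact hs c rfl
  | add s t ihs iht =>
    obtain ⟨u, hu, hu'⟩ := ihs fun c hc => hs c (Or.inl hc)
    obtain ⟨v, hv, hv'⟩ := iht fun c hc => hs c (Or.inr hc)
    exact ⟨u + v, by rw [map_add, hu, hv, Expr.eval], by rw [map_add, hu', hv', Expr.eval]⟩
  | sub s t ihs iht =>
    obtain ⟨u, hu, hu'⟩ := ihs fun c hc => hs c (Or.inl hc)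
    obtain ⟨v, hv, hv'⟩ := iht fun c hc => hs c (Or.inr hc)
    exact ⟨u - v, by rw [map_sub, hu, hv, Expr.eval], by rw [map_sub, hu', hv', Expr.eval]⟩
  | mul s t ihs iht =>
    obtain ⟨u, hu, hu'⟩ := ihs fun c hc => hs c (Or.inl hc)
    obtain ⟨v, hv, hv'⟩ := iht fun c hc => hs c (Or.inr hc)
    exact ⟨u * v, by rw [map_mul, hu, hv, Expr.eval], by rw [map_mul, hu', hv', Expr.eval]⟩
  | div s t ihs iht =>
    obtain ⟨u, hu, hu'⟩ := ihs fun c hc => hs c (Or.inl hc)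
    obtain ⟨v, hv, hv'⟩ := iht fun c hc => hs c (Or.inr hc)
    -- A homomorphism of fields sends `u / 0 = 0` to `0`, so a zero divisor needs no separate case.
    exact ⟨u / v, by rw [map_div₀, hu, hv, Expr.eval], by rw [map_div₀, hu', hv', Expr.eval]⟩

/-- There are strictly increasing sequences of reals of any length that are algebraically
independent over a given countable subfield. -/
theorem exists_strictMono_algebraicIndependent (F : Subfield ℝ) [Countable F] (m : ℕ) :
    ∃ a : Fin m → ℝ, StrictMono a ∧ AlgebraicIndependent F a := by
  obtain ⟨B, hB⟩ := exists_isTranscendenceBasis F ℝ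
  -- With a finite basis, `ℝ` would be algebraic over a countable ring, hence countable.
  have hinf : B.Infinite := fun hfin => by
    have := hfin.countable.to_subtype
    have := hB.isAlgebraic
    have hpoly : Cardinal.mk (MvPolynomial B F) ≤ Cardinal.aleph0 :=
      MvPolynomial.cardinalMk_le_max.trans (max_le (max_le
        (Cardinal.mk_le_aleph0_iff.2 inferInstance) (Cardinal.mk_le_aleph0_iff.2 inferInstance)) le_rfl)
    rw [Cardinal.mk_congr hB.1.aevalEquiv.toEquiv] at hpoly
    refine (Algebra.IsAlgebraic.cardinalMk_le_max (Algebra.adjoin F (Set.range ((↑) : B → ℝ)))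
      ℝ).not_gt ?_
    rw [max_eq_right hpoly, Cardinal.mk_real]
    exact Cardinal.aleph0_lt_continuum
  obtain ⟨t, htB, htc⟩ := hinf.exists_subset_card_eq m
  refine ⟨t.orderEmbOfFin htc, (t.orderEmbOfFin htc).strictMono, ?_⟩
  exact hB.1.comp
    (fun i => ⟨t.orderEmbOfFin htc i, htB (t.orderEmbOfFin_mem htc i)⟩)
    fun i j h => (t.orderEmbOfFin htc).injective ((congrArg Subtype.val h :))

/-- An expression whose value at `a ∘ σ` and at `a ∘ τ` is `a k`, where `a` is algebraically
independent over the field of its constants, forces `τ` and `σ` to list the index `k` at the same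
place. -/
theorem Expr.symm_apply_eq {ι : Type} {m : ℕ} {F : Subfield ℝ} {a : Fin m → ℝ}
    (ha : AlgebraicIndependent F a) {σ τ : Equiv.Perm (Fin m)} {x y : ι → ℝ}
    (hxy : ∀ i, (∃ j, x i = a (σ j) ∧ y i = a (τ j)) ∨ x i ∈ F ∧ y i = x i)
    (s : Expr ι) (hs : s.constants ⊆ F) {k : Fin m} (hx : s.eval x = a k) (hy : s.eval y = a k) :
    σ.symm k = τ.symm k := by
  have ha' : AlgebraicIndependent F (a ∘ σ.symm.trans τ) := ha.comp _ (Equiv.injective _)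
  -- Both maps embed the rational function field in `ℝ`: `φ` sends `X j` to `a j`, and `ψ` sends it
  -- to `a (τ (σ.symm j))`, so that `X (σ j)` lies over both `a (σ j)` and `a (τ j)`.
  let φ : FractionRing (MvPolynomial (Fin m) F) →+* ℝ :=
    IsFractionRing.lift (g := (MvPolynomial.aeval a : MvPolynomial (Fin m) F →ₐ[F] ℝ).toRingHom) ha
  let ψ : FractionRing (MvPolynomial (Fin m) F) →+* ℝ :=
    IsFractionRing.lift (g := (MvPolynomial.aeval (a ∘ σ.symm.trans τ) :
      MvPolynomial (Fin m) F →ₐ[F] ℝ).toRingHom) ha'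
  have hφ : ∀ p, φ (algebraMap _ _ p) = MvPolynomial.aeval a p := fun p =>
    IsFractionRing.lift_algebraMap _ p
  have hψ : ∀ p, ψ (algebraMap _ _ p) = MvPolynomial.aeval (a ∘ σ.symm.trans τ) p := fun p =>
    IsFractionRing.lift_algebraMap _ p
  have hconst : ∀ c ∈ F, ∃ u, φ u = c ∧ ψ u = c := fun c hc =>
    ⟨algebraMap _ _ (MvPolynomial.C (⟨c, hc⟩ : F)), by
      rw [hφ, MvPolynomial.aeval_C]; rfl, by rw [hψ, MvPolynomial.aeval_C]; rfl⟩
  obtain ⟨u, hu, hu'⟩ := s.exists_lift_eval φ ψ (x := x) (y := y) (fun i => by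
    rcases hxy i with ⟨j, hj, hj'⟩ | ⟨h, h'⟩
    · exact ⟨algebraMap _ _ (MvPolynomial.X (σ j)), by rw [hφ, MvPolynomial.aeval_X, hj], by
        rw [hψ, MvPolynomial.aeval_X, hj']; simp⟩
    · rw [h']
      exact hconst _ h) fun c hc => hconst c (hs hc)
  -- Independence makes `φ` injective, so the rational function computed is the variable `X k`;
  -- applying `ψ` then compares `a (τ (σ.symm k))` with `a k`.
  have huk : u = algebraMap _ _ (MvPolynomial.X k) := φ.injective (by
    rw [hu, hx, hφ, MvPolynomial.aeval_X])
  rw [huk, hψ, MvPolynomial.aeval_X, hy] at hu'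
  have := ha.injective hu'
  rw [Equiv.trans_apply] at this
  rw [Equiv.eq_symm_apply, this]

/-! ### Leaves of comparison trees -/

namespace CompTree

variable {ι o : Type}

/-- The leaf that is reached on the input `x`. -/
noncomputable def reachedLeaf (x : ι → ℝ) : CompTree ι o → o → Output ι
  | leaf out => out
  | compare s t a b c =>
      match cmp (s.eval x) (t.eval x) with
      | .lt => a.reachedLeaf x
      | .eq => b.reachedLeaf x
      | .gt => c.reachedLeaf x

theorem result_eq (x : ι → ℝ) (T : CompTree ι o) (k : o) :
    T.result x k = (T.reachedLeaf x k).eval x := by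
  induction T with
  | leaf out => rfl
  | compare s t a b c ha hb hc =>
    rw [result, reachedLeaf]
    cases cmp (s.eval x) (t.eval x) <;> assumption

theorem constants_reachedLeaf_subset (x : ι → ℝ) (T : CompTree ι o) (k : o) :
    (T.reachedLeaf x k).constants ⊆ T.constants := by
  induction T with
  | leaf out => exact Set.subset_iUnion (fun k => (out k).constants) k
  | compare s t a b c ha hb hc =>
    rw [reachedLeaf, constants]
    cases cmp (s.eval x) (t.eval x)
    · exact ha.trans Set.subset_union_left
    · exact hb.trans (Set.subset_union_left.trans Set.subset_union_right)
    · exact hc.trans (Set.subset_union_right.trans Set.subset_union_right)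

/-- A ternary tree of depth `d` distinguishes at most `3 ^ d` inputs. -/
theorem card_le_three_pow {α : Type} (x : α → ι → ℝ) (T : CompTree ι o) (d : ℕ) (S : Finset α)
    (hd : ∀ s ∈ S, T.comparisons (x s) ≤ d)
    (hS : ∀ s ∈ S, ∀ t ∈ S, T.reachedLeaf (x s) = T.reachedLeaf (x t) → s = t) :
    S.card ≤ 3 ^ d := by
  classical
  induction T generalizing d S with
  | leaf out =>
    exact (Finset.card_le_one.2 fun s hs t ht => hS s hs t ht rfl).trans (Nat.one_le_pow _ _ (by norm_num))
  | compare p q a b c ha hb hc =>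
    rcases S.eq_empty_or_nonempty with rfl | ⟨s₀, hs₀⟩
    · simp
    obtain ⟨d, rfl⟩ : ∃ d', d = d' + 1 := by
      have := hd s₀ hs₀
      rw [comparisons] at this
      exact ⟨d - 1, by omega⟩
    let S' (r : Ordering) : Finset α := S.filter fun s => cmp (p.eval (x s)) (q.eval (x s)) = r
    have hlt : (S' .lt).card ≤ 3 ^ d := by
      refine ha d _ (fun s hs => ?_) fun s hs t ht hst => ?_
      · obtain ⟨hs, h⟩ := Finset.mem_filter.1 hs
        have := hd s hs
        rw [comparisons, h] at this
        dsimp only at this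
        omega
      · obtain ⟨hs, h⟩ := Finset.mem_filter.1 hs
        obtain ⟨ht, h'⟩ := Finset.mem_filter.1 ht
        exact hS s hs t ht (by rw [reachedLeaf, reachedLeaf, h, h']; exact hst)
    have heq : (S' .eq).card ≤ 3 ^ d := by
      refine hb d _ (fun s hs => ?_) fun s hs t ht hst => ?_
      · obtain ⟨hs, h⟩ := Finset.mem_filter.1 hs
        have := hd s hs
        rw [comparisons, h] at this
        dsimp only at this
        omega
      · obtain ⟨hs, h⟩ := Finset.mem_filter.1 hs
        obtain ⟨ht, h'⟩ := Finset.mem_filter.1 ht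
        exact hS s hs t ht (by rw [reachedLeaf, reachedLeaf, h, h']; exact hst)
    have hgt : (S' .gt).card ≤ 3 ^ d := by
      refine hc d _ (fun s hs => ?_) fun s hs t ht hst => ?_
      · obtain ⟨hs, h⟩ := Finset.mem_filter.1 hs
        have := hd s hs
        rw [comparisons, h] at this
        dsimp only at this
        omega
      · obtain ⟨hs, h⟩ := Finset.mem_filter.1 hs
        obtain ⟨ht, h'⟩ := Finset.mem_filter.1 ht
        exact hS s hs t ht (by rw [reachedLeaf, reachedLeaf, h, h']; exact hst)
    have hcover : S ⊆ S' .lt ∪ (S' .eq ∪ S' .gt) := fun s hs => by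
      simp only [S', Finset.mem_union, Finset.mem_filter, hs, true_and]
      cases cmp (p.eval (x s)) (q.eval (x s)) <;> simp
    have h₁ := Finset.card_le_card hcover
    have h₂ := Finset.card_union_le (S' .lt) (S' .eq ∪ S' .gt)
    have h₃ := Finset.card_union_le (S' .eq) (S' .gt)
    rw [pow_succ]
    omega

end CompTree

/-! ### Instances that sort -/

/-- The coefficients of the sorting instances: the first `n / 2` unary terms have slope `0` before
and `1` after their first breakpoint, and the others vanish. -/
noncomputable def sortingCoefficients (n K : ℕ) : Coefficients n K where
  slope i p := if (i : ℕ) < n / 2 ∧ p ≠ 0 then 1 else 0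
  wMinus _ := 0
  -- At the edge `n - 2 - k` this is `k + 1/2`, which no integer count equals, so the crossing is a
  -- single point. The levels decrease along the chain, so an earlier cap never hides a later
  -- crossing.
  wPlus e := n - e - 3 / 2

/-- The instance that sorts the values `v`. -/
noncomputable def sortingInstance (n K : ℕ) (v : Fin (n / 2) → ℝ) : Instance n K where
  toCoefficients := sortingCoefficients n K
  breakpoint i _ := if h : (i : ℕ) < n / 2 then v ⟨i, h⟩ else 0

/-- The number of the first `l` of the values `v` that are less than `z`. -/
noncomputable def countLess {m : ℕ} (v : Fin m → ℝ) (l : ℕ) (z : ℝ) : ℕ :=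
  (Finset.univ.filter fun j : Fin m => (j : ℕ) < l ∧ v j < z).card

theorem countLess_le {m : ℕ} (v : Fin m → ℝ) (l : ℕ) (z : ℝ) : countLess v l z ≤ l := by
  have : ((Finset.univ.filter fun j : Fin m => (j : ℕ) < l ∧ v j < z).map
      Fin.valEmbedding).card ≤ (Finset.range l).card :=
    Finset.card_le_card fun i hi => by
      obtain ⟨j, hj, rfl⟩ := Finset.mem_map.1 hi
      exact Finset.mem_range.2 (Finset.mem_filter.1 hj).2.1
  rwa [Finset.card_map, Finset.card_range] at this

theorem countLess_zero {m : ℕ} (v : Fin m → ℝ) (z : ℝ) : countLess v 0 z = 0 :=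
  Nat.le_zero.1 (countLess_le v 0 z)

theorem countLess_succ {m : ℕ} (v : Fin m → ℝ) {l : ℕ} (hl : l < m) (z : ℝ) :
    countLess v (l + 1) z = countLess v l z + if v ⟨l, hl⟩ < z then 1 else 0 := by
  have hnot : ⟨l, hl⟩ ∉ Finset.univ.filter fun j : Fin m => (j : ℕ) < l ∧ v j < z := by simp
  split_ifs with h
  · rw [countLess, countLess, ← Finset.card_insert_of_notMem hnot]
    congr 1
    ext j
    simp only [Finset.mem_filter, Finset.mem_univ, true_and, Finset.mem_insert, Fin.ext_iff]
    constructor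
    · rintro ⟨h₁, h₂⟩
      rcases Nat.lt_succ_iff_lt_or_eq.1 h₁ with h₃ | h₃
      · exact Or.inr ⟨h₃, h₂⟩
      · exact Or.inl h₃
    · rintro (h₁ | ⟨h₁, h₂⟩)
      · obtain rfl : j = ⟨l, hl⟩ := Fin.ext h₁
        exact ⟨Nat.lt_succ_self l, h⟩
      · exact ⟨h₁.trans (Nat.lt_succ_self l), h₂⟩
  · rw [countLess, countLess, add_zero]
    congr 1
    ext j
    simp only [Finset.mem_filter, Finset.mem_univ, true_and]
    constructor
    · rintro ⟨h₁, h₂⟩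
      rcases Nat.lt_succ_iff_lt_or_eq.1 h₁ with h₃ | h₃
      · exact ⟨h₃, h₂⟩
      · obtain rfl : j = ⟨l, hl⟩ := Fin.ext h₃
        exact absurd h₂ h
    · rintro ⟨h₁, h₂⟩
      exact ⟨h₁.trans (Nat.lt_succ_self l), h₂⟩

theorem countLess_comp_perm {m : ℕ} (a : Fin m → ℝ) (σ : Equiv.Perm (Fin m)) (z : ℝ) :
    countLess (a ∘ σ) m z = (Finset.univ.filter fun j => a j < z).card := by
  rw [countLess, ← Finset.card_map σ.toEmbedding]
  congr 1
  ext j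
  simp only [Finset.mem_map_equiv, Finset.mem_filter, Finset.mem_univ, true_and,
    Function.comp_apply, Equiv.apply_symm_apply, Fin.is_lt]

section Sorting

variable {n K : ℕ}

theorem sortingInstance_unaryDeriv (hK : 1 ≤ K) (v : Fin (n / 2) → ℝ) (i : Fin n) (z : ℝ) :
    (sortingInstance n K v).unaryDeriv i z =
      if h : (i : ℕ) < n / 2 then if v ⟨i, h⟩ < z then 1 else 0 else 0 := by
  obtain ⟨K, rfl⟩ : ∃ K', K = K' + 1 := ⟨K - 1, by omega⟩
  by_cases h : (i : ℕ) < n / 2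
  · simp [Instance.unaryDeriv, sortingInstance, sortingCoefficients, h, Fin.sum_univ_succ]
  · simp [Instance.unaryDeriv, sortingInstance, sortingCoefficients, h]

/-- While values are still being added, the count is at most the number of nodes passed and stays
below the cap. Afterwards nothing is added, and each clip replaces the cap by one smaller by `1`. -/
theorem sortingInstance_messageDeriv (hK : 1 ≤ K) (v : Fin (n / 2) → ℝ) (i : ℕ) (hi : i < n)
    (z : ℝ) :
    (sortingInstance n K v).messageDeriv i hi z =
      min (countLess v (min (i + 1) (n / 2)) z : ℝ) (n - i - 1 / 2) := by
  induction i with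
  | zero =>
    rw [Instance.messageDeriv, sortingInstance_unaryDeriv hK]
    have hn : (1 : ℝ) ≤ n := by exact_mod_cast hi
    by_cases h : 0 < n / 2
    · rw [dif_pos h, min_eq_left (show 0 + 1 ≤ n / 2 from h), countLess_succ v h, countLess_zero]
      rw [min_eq_left]
      · push_cast; simp
      · have : (2 : ℝ) ≤ n := by exact_mod_cast (show 2 ≤ n by omega)
        split_ifs <;> push_cast <;> linarith
    · have h₀ : countLess v (min (0 + 1) (n / 2)) z = 0 :=
        Nat.le_zero.1 ((countLess_le v _ z).trans (by omega))
      rw [dif_neg h, h₀, min_eq_left]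
      · simp
      · push_cast; linarith
  | succ i ih =>
    rw [Instance.messageDeriv, sortingInstance_unaryDeriv hK, ih (by omega)]
    have hn : (i : ℝ) + 2 ≤ n := by exact_mod_cast hi
    change _ + clip 0 ((n : ℝ) - i - 3 / 2) _ = _
    have hc : (0 : ℝ) ≤ countLess v (min (i + 1) (n / 2)) z := Nat.cast_nonneg _
    have hclip : clip 0 ((n : ℝ) - i - 3 / 2)
        (min (countLess v (min (i + 1) (n / 2)) z : ℝ) (n - i - 1 / 2)) =
        min (countLess v (min (i + 1) (n / 2)) z : ℝ) (n - i - 3 / 2) := by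
      rw [clip, max_eq_left (le_min hc (by linarith)), min_assoc, min_eq_right (a := _ - 1 / 2)]
      linarith
    rw [hclip]
    push_cast
    by_cases h : i + 1 < n / 2
    · have hi4 : (2 : ℝ) * i + 4 ≤ n := by exact_mod_cast (show 2 * i + 4 ≤ n by omega)
      rw [dif_pos h, min_eq_left (show i + 1 ≤ n / 2 by omega),
        min_eq_left (show i + 1 + 1 ≤ n / 2 by omega), countLess_succ v h]
      have h₁ : (countLess v (i + 1) z : ℝ) ≤ i + 1 := by exact_mod_cast countLess_le v (i + 1) z
      rw [min_eq_left (by linarith), min_eq_left]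
      · push_cast; ring
      · split_ifs <;> push_cast <;> linarith
    · rw [dif_neg h, min_eq_right (show n / 2 ≤ i + 1 by omega),
        min_eq_right (show n / 2 ≤ i + 1 + 1 by omega), zero_add]
      congr 1
      ring

theorem sortingInstance_admissible (v : Fin (n / 2) → ℝ) :
    (sortingInstance n K v).Admissible where
  breakpoint_mono _ _ _ _ := le_rfl
  slope_mono i p q hpq := by
    change (if (i : ℕ) < n / 2 ∧ p ≠ 0 then (1 : ℝ) else 0) ≤
      if (i : ℕ) < n / 2 ∧ q ≠ 0 then 1 else 0
    split_ifs with h h'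
    · exact le_rfl
    · exact absurd ⟨h.1, fun hq => h.2 (Fin.le_zero_iff.1 (hq ▸ hpq))⟩ h'
    · exact zero_le_one
    · exact le_rfl
  wMinus_le_wPlus e := by
    change (0 : ℝ) ≤ n - e - 3 / 2
    have : ((e : ℕ) : ℝ) + 2 ≤ n := by exact_mod_cast (show (e : ℕ) + 2 ≤ n by omega)
    linarith
  attains_min := by
    set P := sortingInstance n K v
    have hdiff : ∀ i (p : Fin K), 0 ≤ P.slope i p.succ - P.slope i p.castSucc := by
      intro i p
      change 0 ≤ (if (i : ℕ) < n / 2 ∧ p.succ ≠ 0 then (1 : ℝ) else 0) -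
        if (i : ℕ) < n / 2 ∧ p.castSucc ≠ 0 then 1 else 0
      by_cases h : (i : ℕ) < n / 2
      · simp only [h, true_and, ne_eq, Fin.succ_ne_zero, not_false_eq_true, if_true]
        split_ifs <;> norm_num
      · simp [h]
    have hzero : ∀ i, P.slope i 0 = 0 := fun i => by
      change (if (i : ℕ) < n / 2 ∧ (0 : Fin (K + 1)) ≠ 0 then (1 : ℝ) else 0) = 0
      simp
    obtain ⟨C, hC⟩ := (Set.finite_range fun q : Fin n × Fin K =>
      P.breakpoint q.1 q.2).bddBelow
    -- All terms are nonnegative, and they vanish at a constant vector below every breakpoint.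
    refine ⟨fun _ => C, fun y => ?_⟩
    have h₁ : P.objective (fun _ => C) = 0 := by
      rw [Instance.objective]
      have hu : ∀ i, P.unary i C = 0 := fun i => by
        rw [Instance.unary, hzero, zero_mul, zero_add]
        refine Finset.sum_eq_zero fun p _ => ?_
        have : C ≤ P.breakpoint i p := hC ⟨(i, p), rfl⟩
        rw [max_eq_right (by linarith), mul_zero]
      simp [hu, Instance.pairwise]
    rw [h₁, Instance.objective]
    refine add_nonneg (Finset.sum_nonneg fun i _ => ?_) (Finset.sum_nonneg fun e _ => ?_)
    · rw [Instance.unary, hzero, zero_mul, zero_add]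
      exact Finset.sum_nonneg fun p _ => mul_nonneg (hdiff i p) (le_max_right _ _)
    · rw [Instance.pairwise]
      split_ifs with h
      · change 0 ≤ 0 * _
        rw [zero_mul]
      · have hw : (0 : ℝ) ≤ P.wPlus e := by
          change (0 : ℝ) ≤ n - e - 3 / 2
          have : ((e : ℕ) : ℝ) + 2 ≤ n := by exact_mod_cast (show (e : ℕ) + 2 ≤ n by omega)
          linarith
        exact mul_nonneg hw (not_lt.1 h)

/-- The edge whose value `λ⁺` is the `k`-th smallest of the values that are sorted. -/
def rankEdge (k : Fin (n / 2)) : Fin (n - 1) := ⟨n - 2 - k, by have := k.isLt; omega⟩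

/-- At `a k` exactly `k` values are strictly smaller, while just above it at least `k + 1` are; the
level `k + 1/2` lies between. The edge comes after all sorted values have been added, so the order
`σ` plays no role. -/
theorem sortingInstance_lambdaPlus (hK : 1 ≤ K) {a : Fin (n / 2) → ℝ} (ha : StrictMono a)
    (σ : Equiv.Perm (Fin (n / 2))) (k : Fin (n / 2)) {l : EReal}
    (hl : (sortingInstance n K (a ∘ σ)).IsLambdaPlus (rankEdge k) l) : l = a k := by
  have hk := k.isLt
  have hcast : ((n - 2 - k : ℕ) : ℝ) = n - 2 - k := by
    rw [Nat.cast_sub (by omega), Nat.cast_sub (by omega)]; norm_num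
  have hw : (sortingInstance n K (a ∘ σ)).wPlus (rankEdge k) = (k : ℝ) + 1 / 2 := by
    change (n : ℝ) - ((n - 2 - k : ℕ) : ℝ) - 3 / 2 = _
    rw [hcast]; ring
  have hm : ∀ z, (sortingInstance n K (a ∘ σ)).messageDeriv (rankEdge k)
      ((rankEdge k).isLt.trans_le (Nat.sub_le _ _)) z
      = min ((Finset.univ.filter fun j => a j < z).card : ℝ) (k + 3 / 2) := fun z => by
    rw [sortingInstance_messageDeriv hK]
    change min (countLess (a ∘ σ) (min (n - 2 - k + 1) (n / 2)) z : ℝ)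
      (n - ((n - 2 - k : ℕ) : ℝ) - 1 / 2) = _
    rw [min_eq_right (show n / 2 ≤ n - 2 - k + 1 by omega), countLess_comp_perm, hcast]
    congr 1
    ring
  obtain ⟨h₁, h₂⟩ := hl
  apply le_antisymm
  · refine EReal.le_of_forall_lt_iff_le.1 fun z hz => h₂.trans (sInf_le ⟨z, ?_, rfl⟩)
    rw [Set.mem_ofPred_eq, hw, hm]
    have hz' : a k < z := by exact_mod_cast hz
    have hcard : (k : ℕ) + 1 ≤ (Finset.univ.filter fun j => a j < z).card := by
      rw [← Fin.card_Iic k]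
      refine Finset.card_le_card fun j hj => ?_
      simpa using (ha.monotone (Finset.mem_Iic.1 hj)).trans_lt hz'
    have : (k : ℝ) + 1 ≤ ((Finset.univ.filter fun j => a j < z).card : ℝ) := by
      exact_mod_cast hcard
    exact lt_min (by linarith) (by linarith)
  · refine le_trans (le_sSup (Set.mem_image_of_mem _ (?_ : a k ∈ _))) h₁
    rw [Set.mem_ofPred_eq, hw, hm]
    have : (Finset.univ.filter fun j => a j < a k) = Finset.Iio k := by
      ext j
      simp [ha.lt_iff_lt]
    rw [this, Fin.card_Iio]
    exact (min_le_left _ _).trans_lt (by linarith)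

end Sorting

/-- An algorithm that makes at most `d` comparisons on admissible instances satisfies
`(n / 2)! ≤ 3 ^ d`. -/
theorem Algorithm.factorial_le_three_pow {n K : ℕ} (hK : 1 ≤ K) (A : Algorithm n K)
    (hA : A.ComputesLambdaPlus) (d : ℕ)
    (hd : ∀ P : Instance n K, P.Admissible → A.comparisons P ≤ d) :
    (n / 2).factorial ≤ 3 ^ d := by
  classical
  set T := A (sortingCoefficients n K)
  -- The tree is fixed before the breakpoints are chosen, so they can be taken independent of its
  -- leaf constants.
  let F : Subfield ℝ := Subfield.closure T.constants
  have : Countable F := by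
    rw [← Cardinal.mk_le_aleph0_iff]
    exact (Subfield.cardinalMk_closure_le_max _).trans
      (max_le (Cardinal.mk_le_aleph0_iff.2 T.countable_constants) le_rfl)
  obtain ⟨a, ha, hind⟩ := exists_strictMono_algebraicIndependent F (n / 2)
  let x (σ : Equiv.Perm (Fin (n / 2))) (q : Fin n × Fin K) : ℝ :=
    (sortingInstance n K (a ∘ σ)).breakpoint q.1 q.2
  have hres : ∀ σ k, (T.reachedLeaf (x σ) (rankEdge k)).eval (x σ) = (a k : EReal) := by
    intro σ k
    rw [← CompTree.result_eq]
    exact sortingInstance_lambdaPlus hK ha σ k (hA _ (sortingInstance_admissible _) _)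
  have hcard := T.card_le_three_pow x d Finset.univ
    (fun σ _ => hd _ (sortingInstance_admissible (a ∘ σ))) fun σ _ τ _ hστ => by
      refine Equiv.symm_bijective.injective (Equiv.ext fun k => ?_)
      have h₁ := hres σ k
      have h₂ := hres τ k
      have h₃ := (T.constants_reachedLeaf_subset (x σ) (rankEdge k)).trans
        Subfield.subset_closure
      rw [← hστ] at h₂
      cases hs : T.reachedLeaf (x σ) (rankEdge k) with
      | negInf => rw [hs] at h₁; exact absurd h₁.symm (EReal.coe_ne_bot _)
      | posInf => rw [hs] at h₁; exact absurd h₁.symm (EReal.coe_ne_top _)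
      | real s =>
        rw [hs] at h₁ h₂ h₃
        refine s.symm_apply_eq hind (x := x σ) (y := x τ) (fun q => ?_) h₃
          (EReal.coe_injective h₁) (EReal.coe_injective h₂)
        by_cases hq : (q.1 : ℕ) < n / 2
        · exact Or.inl ⟨⟨q.1, hq⟩, by simp [x, sortingInstance, hq],
            by simp [x, sortingInstance, hq]⟩
        · exact Or.inr (by simp [x, sortingInstance, hq])
  rwa [Finset.card_univ, Fintype.card_perm, Fintype.card_fin] at hcard

/-! ### From the factorial to `n log n` -/

theorem mul_log_le_log_factorial {n : ℕ} (hn : 16 ≤ n) :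
    (n : ℝ) * Real.log n / 16 ≤ Real.log ((n / 2).factorial : ℝ) := by
  set q := n / 4
  have hn' : (16 : ℝ) ≤ n := by exact_mod_cast hn
  have hq₁ : (n : ℝ) ≤ 4 * (q + 1) := by exact_mod_cast (show n ≤ 4 * (q + 1) by omega)
  -- The upper half of the factors of `(2q)!` are all at least `q + 1`.
  have hfac : (q + 1) ^ q ≤ (n / 2).factorial :=
    calc (q + 1) ^ q ≤ q.factorial * (q + 1) ^ q := Nat.le_mul_of_pos_left _ q.factorial_pos
      _ ≤ (q + q).factorial := Nat.factorial_mul_pow_le_factorial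
      _ ≤ (n / 2).factorial := Nat.factorial_le (by omega)
  have hlog : Real.log n ≤ 2 * Real.log (q + 1) := by
    have : 2 * Real.log (q + 1) = Real.log (((q : ℝ) + 1) ^ 2) := by
      rw [Real.log_pow]; norm_num
    rw [this]
    apply Real.log_le_log (by linarith)
    nlinarith
  have hlog₀ : 0 ≤ Real.log n := Real.log_nonneg (by linarith)
  have hle : (q : ℝ) * Real.log (q + 1) ≤ Real.log ((n / 2).factorial : ℝ) := by
    rw [← Real.log_pow]
    exact Real.log_le_log (by positivity) (by exact_mod_cast hfac)
  have hq₂ : (n : ℝ) / 8 ≤ q := by linarith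
  calc (n : ℝ) * Real.log n / 16 = n / 8 * (Real.log n / 2) := by ring
    _ ≤ q * Real.log (q + 1) := mul_le_mul hq₂ (by linarith) (by linarith) (Nat.cast_nonneg _)
    _ ≤ _ := hle

end TVChain

theorem mainTheorem5 :
    ∃ c : ℝ, 0 < c ∧ ∃ n₀ : ℕ, ∀ n : ℕ, n₀ ≤ n → ∀ K : ℕ, 1 ≤ K →
      ∀ A : TVChain.Algorithm n K, A.ComputesLambdaPlus →
        ∃ P : TVChain.Instance n K, P.Admissible ∧
          c * ((n : ℝ) * Real.log n) ≤ (A.comparisons P : ℝ) := by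
  -- With `log 3 ≤ 2`, fewer comparisons would give `log (n / 2)!` at most `n log n / 32`, against
  -- the lower bound `n log n / 16`.
  refine ⟨1 / 64, by norm_num, 16, fun n hn K hK A hA => ?_⟩
  by_contra! hcon
  have hn' : (16 : ℝ) ≤ n := by exact_mod_cast hn
  have hpos : 0 < (n : ℝ) * Real.log n := mul_pos (by linarith) (Real.log_pos (by linarith))
  have hfac := A.factorial_le_three_pow hK hA ⌊1 / 64 * ((n : ℝ) * Real.log n)⌋₊ fun P hP =>
    Nat.le_floor (hcon P hP).le
  have hfloor := Nat.floor_le (show 0 ≤ 1 / 64 * ((n : ℝ) * Real.log n) by positivity)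
  have hlog : Real.log ((n / 2).factorial : ℝ) ≤
      ⌊1 / 64 * ((n : ℝ) * Real.log n)⌋₊ * Real.log 3 := by
    rw [← Real.log_pow]
    exact Real.log_le_log (by exact_mod_cast Nat.factorial_pos _) (by exact_mod_cast hfac)
  have hlog3 : Real.log 3 ≤ 2 := by
    have := Real.log_le_sub_one_of_pos (show (0 : ℝ) < 3 by norm_num)
    linarith
  have hlog3' : 0 ≤ Real.log 3 := Real.log_nonneg (by norm_num)
  have h := TVChain.mul_log_le_log_factorial hn
  have := mul_le_mul hfloor hlog3 hlog3' (by positivity)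
  linarith
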